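/- All graphs are finite and simple. Let $q,s\ge 1$ be integers and let $\mathbf{t}=(t_1,\dots,t_q)$ be a tuple of positive integers. Write $\|\mathbf{t}\|_\infty=\max_i t_i$ and $\Lambda_{\mathbf{t}}=\sum_{i=1}^q (t_i-1)$, and let $n$ be an integer with $$n\ \ge\ \|\mathbf{t}\|_\infty+\Lambda_{\mathbf{t}}+1+7(q+1)(s-1).$$ Let $G=(V,E)$ be an $n$-vertex $s$-connector, that is, a graph with $|V|=n$ such that for all disjoint $X,Y\subseteq V$ with $|X|,|Y|\ge s$ there is an edge of $G$ with one endpoint in $X$ and the other in $Y$ (equivalently, the complement of $G$ contains no $K_{s,s}$ as a subgraph). Then $G\to(t_1K_2,\dots,t_qK_2)$: for every colouring of the edges of $G$ with colours $1,\dots,q$ there is some $j\in\{1,\dots,q\}$ such that the edges of colour $j$ contain a matching of size $t_j$, i.e. $t_j$ pairwise disjoint edges. -/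

import Mathlib

/-- `G` is an `s`-connector: any two disjoint vertex sets with at least `s` vertices each are
joined by an edge of `G`. -/
def SimpleGraph.IsConnector {V : Type*} (G : SimpleGraph V) (s : ℕ) : Prop :=
  ∀ X Y : Finset V, Disjoint X Y → s ≤ X.card → s ≤ Y.card →
    ∃ x ∈ X, ∃ y ∈ Y, G.Adj x y

/-- The matching `t K₂`: the graph with `t` pairwise disjoint edges `{(i, 0), (i, 1)}`
and no further vertices. -/
def matchingGraph (t : ℕ) : SimpleGraph (Fin t × Fin 2) where
  Adj u v := u.1 = v.1 ∧ u.2 ≠ v.2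
  symm := ⟨fun _ _ h => ⟨h.1.symm, h.2.symm⟩⟩
  loopless := ⟨fun _ h => h.2 rfl⟩

/-- The Ramsey arrow `G → (H₁, …, H_q)`: for every colouring of the edges of `G` with `q` colours
there is a colour `j` such that the graph of the edges of colour `j` contains a copy of `H_j`
(as a subgraph, not necessarily induced). -/
def SimpleGraph.Arrows {V : Type*} (G : SimpleGraph V) {q : ℕ} {W : Fin q → Type*}
    (H : ∀ j, SimpleGraph (W j)) : Prop :=
  ∀ c : G.EdgeLabeling (Fin q), ∃ j : Fin q, (H j).IsContained (c.labelGraph j)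

/-! Suppose no colour j has t_j disjoint edges. Tutte-Berge gives a vertex set `S j` and edges `E j`
with 2|S j| + |E j| ≤ 2(t_j - 1) such that, off `S j`, each edge of colour j stays within a
component of `E j`. Let W be the complement of all the `S j`, and m = s - 1. For a set I of colours,
each edge of G inside W stays within a component of the union of `E j` over I or over Iᶜ. The
connector property then gives one of these two graphs a component missing at most 3m vertices of W
(`exists_large_class_of_cover`). The empty set of colours has no such component, so inserting
colours one at a time yields I and k ∉ I for which both I ∪ {k} and Iᶜ have one. A component on c
vertices needs c - 1 edges, and only `E k` is counted twice; hence n ≤ Λ + t_k + 3m, a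
contradiction. -/

open Finset SimpleGraph

/-! ### Tutte-Berge from Tutte's theorem -/

/-- The join of `H` with a complete graph on `d` new vertices. -/
def joinClique {V : Type*} (H : SimpleGraph V) (d : ℕ) : SimpleGraph (V ⊕ Fin d) where
  Adj x y := x ≠ y ∧ ∀ u v, x = .inl u → y = .inl v → H.Adj u v
  symm := ⟨fun _ _ h => ⟨h.1.symm, fun u v hu hv => (h.2 v u hv hu).symm⟩⟩
  loopless := ⟨fun _ h => h.1 rfl⟩

/-- A fixed-point-free involution of a finset of size at least `2 * t` along edges of `H`
gives `t` disjoint edges. -/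
lemma matchingGraph_isContained_of_involution {V : Type*} [DecidableEq V]
    (H : SimpleGraph V) (t : ℕ) (A : Finset V) (hA : 2 * t ≤ #A) (p : V → V)
    (hpA : ∀ v ∈ A, p v ∈ A) (hpp : ∀ v ∈ A, p (p v) = v) (hadj : ∀ v ∈ A, H.Adj v (p v)) :
    (matchingGraph t).IsContained H := by
  classical
  -- An arbitrary order, to represent each pair {v, p v} by its smaller element.
  let _ : LinearOrder V := linearOrderOfSTO WellOrderingRel
  let X := A.filter fun v => v < p v
  have hX : A ⊆ X ∪ X.image p := by
    intro v hv
    rcases lt_trichotomy v (p v) with h | h | h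
    · exact mem_union_left _ (mem_filter.2 ⟨hv, h⟩)
    · exact absurd h (hadj v hv).ne
    · refine mem_union_right _ (mem_image.2 ⟨p v, mem_filter.2 ⟨hpA v hv, ?_⟩, hpp v hv⟩)
      rwa [hpp v hv]
  have hXt : t ≤ #X := by
    have h1 := card_le_card hX
    have h2 := card_union_le X (X.image p)
    have h3 : #(X.image p) ≤ #X := card_image_le
    omega
  obtain ⟨Y, hYX, hY⟩ := exists_subset_card_eq hXt
  let e : Fin t ≃ Y := (Y.equivFinOfCardEq hY).symm
  have heX : ∀ i, (e i : V) ∈ A ∧ (e i : V) < p (e i) := fun i => mem_filter.1 (hYX (e i).2)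
  let g : Fin t × Fin 2 → V := fun x => if x.2 = 0 then e x.1 else p (e x.1)
  have hg : ∀ x y, (matchingGraph t).Adj x y → H.Adj (g x) (g y) := by
    rintro ⟨i, a⟩ ⟨j, b⟩ ⟨h1, h2⟩
    obtain rfl : i = j := h1
    have h := hadj _ (heX i).1
    fin_cases a <;> fin_cases b
    · exact absurd rfl h2
    · simpa [g] using h
    · simpa [g] using h.symm
    · exact absurd rfl h2
  have hpinj : ∀ i j, p (e i) = p (e j) → i = j := by
    intro i j h
    have := congrArg p h
    rw [hpp _ (heX i).1, hpp _ (heX j).1] at this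
    exact e.injective (Subtype.ext this)
  have hne : ∀ i j, (e i : V) ≠ p (e j) := by
    intro i j h
    have h1 := (heX i).2
    rw [h, hpp _ (heX j).1] at h1
    exact lt_asymm h1 (heX j).2
  refine ⟨⟨⟨g, fun {x y} h => hg x y h⟩, ?_⟩⟩
  rintro ⟨i, a⟩ ⟨j, b⟩ h
  change g (i, a) = g (j, b) at h
  fin_cases a <;> fin_cases b
  · have h' : e i = e j := Subtype.ext (by simpa [g] using h)
    rw [e.injective h']
  · exact absurd (by simpa [g] using h) (hne i j)
  · exact absurd (by simpa [g] using h.symm) (hne j i)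
  · rw [hpinj i j (by simpa [g] using h)]

/-- A perfect matching of the join of `H` with `d` universal vertices leaves a large matching of `H`. -/
lemma matchingGraph_isContained_of_isPerfectMatching {V : Type*} [Fintype V] (H : SimpleGraph V)
    (t d : ℕ) (hd : 2 * t + d ≤ Fintype.card V) (M : (joinClique H d).Subgraph)
    (hM : M.IsPerfectMatching) : (matchingGraph t).IsContained H := by
  classical
  rw [Subgraph.isPerfectMatching_iff] at hM
  choose p hp hpu using hM
  have hpp : ∀ x, p (p x) = x := fun x => (hpu _ _ (hp x).symm).symm
  let A : Finset V := univ.filter fun v => ∃ w, p (.inl v) = .inl w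
  have hB : #(univ.filter fun v : V => ¬ ∃ w, p (.inl v) = .inl w) ≤ d := by
    have : ∀ v ∈ univ.filter (fun v : V => ¬ ∃ w, p (.inl v) = .inl w),
        p (.inl v) ∈ (univ : Finset (Fin d)).map Function.Embedding.inr := by
      intro v hv
      simp only [mem_filter, mem_univ, true_and] at hv
      rcases h : p (.inl v) with w | w
      · exact absurd ⟨w, h⟩ hv
      · simp
    have := card_le_card_of_injOn (fun v => p (.inl v)) this (by
      intro a _ b _ hab
      have := congrArg p hab
      simpa [hpp] using this)
    simpa using this
  have hAB := card_filter_add_card_filter_not (s := (univ : Finset V))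
    (fun v => ∃ w, p (.inl v) = .inl w)
  have hpA : ∀ v ∈ A, ∃ w, p (.inl v) = .inl w := fun v hv => by simpa [A] using hv
  choose! f hf using hpA
  have hff : ∀ v ∈ A, p (.inl (f v)) = .inl v := fun v hv => by rw [← hf v hv, hpp]
  have hfA : ∀ v ∈ A, f v ∈ A := fun v hv => by simpa [A] using ⟨v, hff v hv⟩
  refine matchingGraph_isContained_of_involution H t A ?_ f hfA ?_ ?_
  · rw [card_univ] at hAB
    change 2 * t ≤ #(univ.filter fun v : V => ∃ w, p (.inl v) = .inl w)
    omega
  · intro v hv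
    have h1 := hf (f v) (hfA v hv)
    rw [hff v hv] at h1
    exact (Sum.inl_injective h1).symm
  · intro v hv
    have := (hp (.inl v)).adj_sub
    rw [hf v hv] at this
    exact this.2 v (f v) rfl rfl

/-- A set of vertices connected by the edges of `E` has at most `#E + 1` elements. -/
lemma card_le_card_edges_add_one_of_reachable {V : Type*} [Finite V] (E : Finset (Sym2 V)) (v : V)
    (A : Finset V) (hA : ∀ w ∈ A, (fromEdgeSet (E : Set (Sym2 V))).Reachable v w) :
    #A ≤ #E + 1 := by
  classical
  set T := fromEdgeSet (E : Set (Sym2 V))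
  let C := T.connectedComponentMk v
  have h1 := C.connected_toSimpleGraph.card_vert_le_card_edgeSet_add_one
  have h2 : #A ≤ Nat.card C := by
    rw [← Set.ncard_coe_finset]
    exact Set.ncard_le_ncard (t := C.supp) fun w hw => ConnectedComponent.sound (hA w hw).symm
  have h3 : Nat.card C.toSimpleGraph.edgeSet ≤ #E := by
    rw [Nat.card_coe_set_eq, ← Set.ncard_coe_finset]
    refine Set.ncard_le_ncard_of_injOn (Sym2.map Subtype.val) ?_
      (Sym2.map.injective Subtype.val_injective).injOn
    intro e he
    induction e using Sym2.ind with
    | h x y =>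
      have : T.Adj x y := he
      exact ((fromEdgeSet_adj _).1 this).1
  omega

/-- Stars inside the fibres of `f` on the complement of `S` connect each fibre with few edges. -/
lemma exists_edges_connecting_fibres {V C : Type*} [Fintype V] [DecidableEq V]
    [DecidableEq C]
    (S : Finset V)
    (f : V → C) (O : Finset C) (hO : ∀ c ∈ O, ∃ v ∉ S, f v = c) :
    ∃ E : Finset (Sym2 V), #E + #S + #O ≤ Fintype.card V ∧
      ∀ u ∉ S, ∀ v ∉ S, f u = f v → (fromEdgeSet (E : Set (Sym2 V))).Reachable u v := by
  rcases isEmpty_or_nonempty V with hV | hV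
  · have : O = ∅ := eq_empty_of_forall_notMem fun c hc => hV.elim (hO c hc).choose
    exact ⟨∅, by simp [this, eq_empty_of_isEmpty S], fun u => hV.elim u⟩
  have hO' : ∀ c ∈ Sᶜ.image f, ∃ v ∉ S, f v = c := by simp
  choose! r hrS hr using hO'
  let R := (Sᶜ.image f).image r
  have hRS : R ⊆ Sᶜ := by
    intro x hx
    obtain ⟨c, hc, rfl⟩ := mem_image.1 hx
    simpa using hrS c hc
  have hR : #R = #(Sᶜ.image f) := card_image_of_injOn fun a ha b hb hab => by
    rw [← hr a ha, ← hr b hb, hab]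
  have hOle : #O ≤ #(Sᶜ.image f) := card_le_card fun c hc => by
    obtain ⟨v, hv, rfl⟩ := hO c hc
    exact mem_image_of_mem _ (by simpa using hv)
  let E := (Sᶜ \ R).image fun v => s(v, r (f v))
  have hE : #E ≤ #(Sᶜ \ R) := card_image_le
  have hreach : ∀ u ∉ S, (fromEdgeSet (E : Set (Sym2 V))).Reachable u (r (f u)) := by
    intro u hu
    by_cases huR : u ∈ R
    · obtain ⟨c, hc, rfl⟩ := mem_image.1 huR
      rw [hr c hc]
    · by_cases h : u = r (f u)
      · rw [← h]
      · refine Adj.reachable ?_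
        rw [fromEdgeSet_adj]
        refine ⟨?_, h⟩
        exact mem_coe.2 (mem_image.2 ⟨u, by simp [hu, huR], rfl⟩)
  refine ⟨E, ?_, fun u hu v hv huv => (hreach u hu).trans (huv ▸ (hreach v hv).symm)⟩
  have := card_sdiff_add_card_eq_card hRS
  have := card_compl_add_card S
  omega

/-- A form of the Tutte-Berge formula: if `H` has no matching of size `t`, then after deleting a set
`S` the components of `H` are connected by a set `E` of edges with `2 * #S + #E ≤ 2 * (t - 1)`. -/
lemma two_mul_card_add_card_le_of_not_isContained {V : Type*} [Fintype V] [DecidableEq V]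
    (H : SimpleGraph V) (t : ℕ)
    (ht : 1 ≤ t) (hH : ¬ (matchingGraph t).IsContained H) :
    ∃ (S : Finset V) (E : Finset (Sym2 V)), 2 * #S + #E ≤ 2 * (t - 1) ∧
      ∀ u ∉ S, ∀ v ∉ S, H.Adj u v → (fromEdgeSet (E : Set (Sym2 V))).Reachable u v := by
  classical
  rcases lt_or_ge (Fintype.card V) (2 * t) with hn | hn
  · rcases isEmpty_or_nonempty V with hV | ⟨⟨v₀⟩⟩
    · exact ⟨∅, ∅, by simp, fun u => hV.elim u⟩
    -- With fewer than 2t vertices, a spanning star has at most 2(t - 1) edges.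
    · obtain ⟨E, hE, h⟩ := exists_edges_connecting_fibres (∅ : Finset V) (fun _ => ()) {()}
        (fun c _ => ⟨v₀, by simp, rfl⟩)
      simp only [card_empty, card_singleton] at hE
      exact ⟨∅, E, by simp only [card_empty]; omega, fun u hu v hv _ => h u hu v hv rfl⟩
  · obtain ⟨d, hd⟩ := Nat.exists_eq_add_of_le hn
    have hU : ∃ U, (joinClique H d).IsTutteViolator U := by
      by_contra hU
      push Not at hU
      obtain ⟨M, hM⟩ := tutte.2 hU
      exact hH (matchingGraph_isContained_of_isPerfectMatching H t d hd.ge M hM)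
    obtain ⟨U, hU⟩ := hU
    have hcard : Nat.card (V ⊕ Fin d) = 2 * t + 2 * d := by
      simp [hd]; omega
    set K := ((⊤ : (joinClique H d).Subgraph).deleteVerts U).coe with hK
    have hX : ∀ x, x ∈ ((⊤ : (joinClique H d).Subgraph).deleteVerts U).verts ↔ x ∉ U := by
      intro x; simp
    have hKadj : ∀ x y, K.Adj x y ↔ (joinClique H d).Adj x y := by
      intro x y
      have hx := (hX _).1 x.2
      have hy := (hX _).1 y.2
      simp [hK, hx, hy]
    have hodd : Odd K.oddComponents.ncard ↔ Odd U.ncard := by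
      rw [odd_ncard_oddComponents]
      have h1 := Set.ncard_add_ncard_compl U
      have h2 : Nat.card ((⊤ : (joinClique H d).Subgraph).deleteVerts U).verts = Uᶜ.ncard := by
        rw [Nat.card_coe_set_eq]; congr 1; ext x; simp
      rw [h2]
      rw [hcard] at h1
      rw [Nat.odd_iff, Nat.odd_iff]; omega
    have hlt : U.ncard < K.oddComponents.ncard := hU
    -- The join has even order, so the two counts agree in parity and the excess is at least 2.
    have hlt2 : U.ncard + 2 ≤ K.oddComponents.ncard := by
      rw [Nat.odd_iff, Nat.odd_iff] at hodd; omega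
    -- A surviving universal vertex would leave a single component, but at least two are odd.
    have hD : ∀ i, .inr i ∈ U := by
      intro i
      by_contra hi
      let a : ((⊤ : (joinClique H d).Subgraph).deleteVerts U).verts := ⟨.inr i, (hX _).2 hi⟩
      have hpre : ∀ x, K.Reachable a x := by
        intro x
        by_cases hx : a = x
        · rw [hx]
        · refine Adj.reachable ((hKadj _ _).2 ⟨fun h => hx (Subtype.ext h), ?_⟩)
          intro u v hu; cases hu
      have : K.oddComponents ⊆ {K.connectedComponentMk a} := by
        intro c _
        induction c using ConnectedComponent.ind with
        | h x => exact ConnectedComponent.sound (hpre x).symm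
      have := Set.ncard_le_ncard this
      rw [Set.ncard_singleton] at this
      omega
    let S : Finset V := univ.filter fun v => .inl v ∈ U
    have hUcard : U.ncard = #S + d := by
      have : U = ((S.disjSum (univ : Finset (Fin d)) : Finset (V ⊕ Fin d)) : Set (V ⊕ Fin d)) := by
        ext (v | i)
        · simp [S]
        · simp [hD i]
      rw [this, Set.ncard_coe_finset, card_disjSum, card_univ, Fintype.card_fin]
    -- The value `none` is taken only on `S`, where fibres play no role.
    let f : V → Option K.ConnectedComponent := fun v =>
      if h : .inl v ∈ U then none else some (K.connectedComponentMk ⟨.inl v, (hX _).2 h⟩)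
    have hf : ∀ v (h : Sum.inl v ∉ U), f v = some (K.connectedComponentMk ⟨.inl v, (hX _).2 h⟩) :=
      fun v h => dif_neg h
    have hfin : K.oddComponents.Finite := Set.toFinite _
    obtain ⟨E, hE, h⟩ := exists_edges_connecting_fibres S f (hfin.toFinset.map Function.Embedding.some) (by
      intro c hc
      obtain ⟨c, -, rfl⟩ := mem_map.1 hc
      induction c using ConnectedComponent.ind with
      | h x =>
        obtain ⟨x | i, hx⟩ := x
        · have hx' := (hX _).1 hx
          exact ⟨x, by simpa [S] using hx', hf x hx'⟩
        · exact absurd (hD i) ((hX _).1 hx))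
    rw [card_map, ← Set.ncard_eq_toFinset_card] at hE
    -- The count is |E| + |S| + (|S| + d + 2) ≤ |V| = 2t + d.
    refine ⟨S, E, by omega, fun u hu v hv huv => h u hu v hv ?_⟩
    have hu' : Sum.inl u ∉ U := by simpa [S] using hu
    have hv' : Sum.inl v ∉ U := by simpa [S] using hv
    rw [hf u hu', hf v hv']
    congr 1
    refine ConnectedComponent.sound (Adj.reachable ((hKadj _ _).2 ⟨?_, ?_⟩))
    · simpa using huv.ne
    · rintro a b ha hb
      cases ha; cases hb; exact huv

/-! ### Large classes in connectors -/

/-- A set which is not dominated by one class of `r` is split by a union of classes. -/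
lemma exists_balanced_closed_of_no_large_class {V : Type*} [Fintype V] [DecidableEq V]
    (r : Setoid V) (W : Finset V)
    (m : ℕ) (hW : 9 * m < #W)
    (hr : ∀ v, ∀ C ⊆ W, (∀ w ∈ C, r v w) → #C + 3 * m < #W) :
    ∃ A : Finset V, (∀ x ∈ A, ∀ y, r x y → y ∈ A) ∧ 3 * m < #(W ∩ A) ∧ 3 * m < #(W \ A) := by
  classical
  let cls : V → Finset V := fun v => univ.filter fun w => r v w
  have hcls : ∀ v, ∀ x ∈ cls v, ∀ y, r x y → y ∈ cls v := by
    intro v x hx y hxy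
    simp only [cls, mem_filter, mem_univ, true_and] at hx ⊢
    exact r.trans hx hxy
  by_cases hbig : ∃ v, 3 * m < #(W ∩ cls v)
  · obtain ⟨v, hv⟩ := hbig
    refine ⟨cls v, hcls v, hv, ?_⟩
    have h1 := hr v (W ∩ cls v) inter_subset_left fun w hw => by simpa [cls] using (mem_inter.1 hw).2
    have h2 := card_inter_add_card_sdiff W (cls v)
    omega
  · push Not at hbig
    -- All classes now meet W in at most 3m points, so a maximal union within the bound 6m must
    -- exceed 3m, and it leaves more than 9m - 6m.
    let P : Finset (Finset V) := univ.filter fun A =>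
      (∀ x ∈ A, ∀ y, r x y → y ∈ A) ∧ #(W ∩ A) ≤ 6 * m
    obtain ⟨A, hAP, hmax⟩ := exists_max_image P (fun A => #A) ⟨∅, by simp [P]⟩
    obtain ⟨hA, hA6⟩ := (mem_filter.1 hAP).2
    have hsplit := card_inter_add_card_sdiff W A
    refine ⟨A, hA, ?_, by omega⟩
    by_contra! h3
    obtain ⟨w, hw⟩ : (W \ A).Nonempty := card_pos.1 (by omega)
    have hin : A ∪ cls w ∈ P := by
      refine mem_filter.2 ⟨mem_univ _, ?_, ?_⟩
      · intro x hx y hxy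
        rcases mem_union.1 hx with hx | hx
        · exact mem_union_left _ (hA x hx y hxy)
        · exact mem_union_right _ (hcls w x hx y hxy)
      · rw [inter_union_distrib_left]
        have := card_union_le (W ∩ A) (W ∩ cls w)
        have := hbig w
        omega
    have hlt : #A < #(A ∪ cls w) := card_lt_card <| by
      refine Finset.ssubset_iff_subset_ne.2 ⟨subset_union_left, fun h => (mem_sdiff.1 hw).2 ?_⟩
      rw [h]
      exact mem_union_right _ (by simp [cls])
    exact absurd (hmax _ hin) (not_le.2 hlt)

/-- If the classes of `r` contain all edges of a connector between two large sets, then one class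
contains almost all of these two sets. -/
lemma exists_large_class_of_bipartite {V : Type*} [Fintype V] [DecidableEq V]
    (G : SimpleGraph V) (m : ℕ)
    (hG : G.IsConnector (m + 1)) (r : Setoid V) (X Y : Finset V) (hXY : Disjoint X Y)
    (hX : 3 * m < #X) (hY : 3 * m < #Y) (hr : ∀ x ∈ X, ∀ y ∈ Y, G.Adj x y → r x y) :
    ∃ v, ∃ C ⊆ X ∪ Y, (∀ w ∈ C, r v w) ∧ #(X ∪ Y) ≤ #C + 2 * m := by
  classical
  let cls : V → Finset V := fun v => univ.filter fun w => r v w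
  have hcls : ∀ v, ∀ x ∈ cls v, ∀ y, r x y → y ∈ cls v := by
    intro v x hx y hxy
    simp only [cls, mem_filter, mem_univ, true_and] at hx ⊢
    exact r.trans hx hxy
  -- No edge leaves a closed set across X, Y, so it is small on both sides or almost full on both.
  have key : ∀ A : Finset V, (∀ x ∈ A, ∀ y, r x y → y ∈ A) →
      (#(X ∩ A) ≤ m ∧ #(Y ∩ A) ≤ m) ∨ (#(X \ A) ≤ m ∧ #(Y \ A) ≤ m) := by
    intro A hA
    have h1 : #(X ∩ A) ≤ m ∨ #(Y \ A) ≤ m := by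
      by_contra! h
      obtain ⟨x, hx, y, hy, hxy⟩ := hG (X ∩ A) (Y \ A)
        (hXY.mono inter_subset_left sdiff_subset) h.1 h.2
      rw [mem_inter] at hx
      rw [mem_sdiff] at hy
      exact hy.2 (hA x hx.2 y (hr x hx.1 y hy.1 hxy))
    have h2 : #(X \ A) ≤ m ∨ #(Y ∩ A) ≤ m := by
      by_contra! h
      obtain ⟨x, hx, y, hy, hxy⟩ := hG (X \ A) (Y ∩ A)
        (hXY.mono sdiff_subset inter_subset_left) h.1 h.2
      rw [mem_inter] at hy
      rw [mem_sdiff] at hx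
      exact hx.2 (hA y hy.2 x (r.symm (hr x hx.1 y hy.1 hxy)))
    have h3 := card_inter_add_card_sdiff X A
    have h4 := card_inter_add_card_sdiff Y A
    omega
  by_cases hbig : ∃ v, #(X \ cls v) ≤ m ∧ #(Y \ cls v) ≤ m
  · obtain ⟨v, hvX, hvY⟩ := hbig
    refine ⟨v, (X ∪ Y) ∩ cls v, inter_subset_left,
      fun w hw => by simpa [cls] using (mem_inter.1 hw).2, ?_⟩
    have h1 := card_inter_add_card_sdiff (X ∪ Y) (cls v)
    have h2 := card_union_le (X \ cls v) (Y \ cls v)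
    rw [← union_sdiff_distrib] at h2
    omega
  · exfalso
    let P : Finset (Finset V) := univ.filter fun A =>
      (∀ x ∈ A, ∀ y, r x y → y ∈ A) ∧ #(X ∩ A) ≤ m ∧ #(Y ∩ A) ≤ m
    obtain ⟨A, hAP, hmax⟩ := exists_max_image P (fun A => #A) ⟨∅, by simp [P]⟩
    obtain ⟨hA, hAX, hAY⟩ := (mem_filter.1 hAP).2
    have hsplit := card_inter_add_card_sdiff X A
    obtain ⟨w, hw⟩ : (X \ A).Nonempty := card_pos.1 (by omega)
    have hclosed : ∀ x ∈ A ∪ cls w, ∀ y, r x y → y ∈ A ∪ cls w := by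
      intro x hx y hxy
      rcases mem_union.1 hx with hx | hx
      · exact mem_union_left _ (hA x hx y hxy)
      · exact mem_union_right _ (hcls w x hx y hxy)
    have hw' := (key (cls w) (hcls w)).resolve_right fun h => hbig ⟨w, h⟩
    -- The enlarged set has at most 2m points in X, so it misses more than m and must be small
    -- again.
    have hin : A ∪ cls w ∈ P := by
      refine mem_filter.2 ⟨mem_univ _, hclosed, (key _ hclosed).resolve_right ?_⟩
      rintro ⟨h, -⟩
      have h1 := card_inter_add_card_sdiff X (A ∪ cls w)
      have h2 := card_union_le (X ∩ A) (X ∩ cls w)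
      rw [← inter_union_distrib_left] at h2
      omega
    have hlt : #A < #(A ∪ cls w) := card_lt_card <| by
      refine Finset.ssubset_iff_subset_ne.2 ⟨subset_union_left, fun h => (mem_sdiff.1 hw).2 ?_⟩
      rw [h]
      exact mem_union_right _ (by simp [cls])
    exact absurd (hmax _ hin) (not_le.2 hlt)

/-- If two equivalence relations cover the edges of a connector inside `W`, then one of them has a
class containing almost all of `W`. -/
lemma exists_large_class_of_cover {V : Type*} [Fintype V] [DecidableEq V]
    (G : SimpleGraph V) (m : ℕ)
    (hG : G.IsConnector (m + 1)) (r r' : Setoid V) (W : Finset V) (hW : 9 * m < #W)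
    (hr : ∀ x ∈ W, ∀ y ∈ W, G.Adj x y → r x y ∨ r' x y) :
    (∃ v, ∃ C ⊆ W, (∀ w ∈ C, r v w) ∧ #W ≤ #C + 3 * m) ∨
      ∃ v, ∃ C ⊆ W, (∀ w ∈ C, r' v w) ∧ #W ≤ #C + 3 * m := by
  by_cases h : ∃ v, ∃ C ⊆ W, (∀ w ∈ C, r v w) ∧ #W ≤ #C + 3 * m
  · exact .inl h
  push Not at h
  obtain ⟨A, hA, h1, h2⟩ := exists_balanced_closed_of_no_large_class r W m hW h
  obtain ⟨v, C, hC, hvC, hcard⟩ := exists_large_class_of_bipartite G m hG r' (W ∩ A) (W \ A)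
    (disjoint_sdiff_inter W A).symm h1 h2 fun x hx y hy hxy => by
      rw [mem_inter] at hx
      rw [mem_sdiff] at hy
      exact (hr x hx.1 y hy.1 hxy).resolve_left fun hrxy => hy.2 (hA x hx.2 y hrxy)
  have hWu : W ∩ A ∪ W \ A = W := by ext x; simp only [mem_union, mem_inter, mem_sdiff]; tauto
  rw [hWu] at hC hcard
  exact .inr ⟨v, C, hC, hvC, by omega⟩

/-! ### The colouring argument -/

theorem theorem1p1 (q s : ℕ) (hq : 1 ≤ q) (hs : 1 ≤ s)
    (t : Fin q → ℕ) (ht : ∀ i, 1 ≤ t i) (n : ℕ)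
    (hn : Finset.univ.sup t + (∑ i, (t i - 1)) + 1 + 7 * (q + 1) * (s - 1) ≤ n)
    {V : Type*} [Fintype V] (hV : Fintype.card V = n)
    (G : SimpleGraph V) (hG : G.IsConnector s) :
    G.Arrows (fun j => matchingGraph (t j)) := by
  classical
  intro c
  by_contra hc
  rw [not_exists] at hc
  choose S E hSE hreach using fun j =>
    two_mul_card_add_card_le_of_not_isContained (c.labelGraph j) (t j) (ht j) (hc j)
  obtain ⟨m, rfl⟩ : ∃ m, s = m + 1 := ⟨s - 1, by omega⟩
  rw [Nat.add_sub_cancel] at hn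
  have hqm : 14 * m ≤ 7 * (q + 1) * m := Nat.mul_le_mul_right m (by omega)
  let W : Finset V := (univ.biUnion S)ᶜ
  have hWS : ∀ w ∈ W, ∀ j, w ∉ S j := by
    intro w hw j hj
    exact (mem_compl.1 hw) (mem_biUnion.2 ⟨j, mem_univ _, hj⟩)
  have hWcard : n ≤ #W + ∑ j, #(S j) := by
    have h1 := card_compl_add_card (univ.biUnion S)
    have h2 : #(univ.biUnion S) ≤ ∑ j, #(S j) := card_biUnion_le
    change #W + _ = _ at h1
    omega
  have hSt : ∑ j, #(S j) ≤ ∑ j, (t j - 1) := sum_le_sum fun j _ => by have := hSE j; omega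
  have hsup : ∀ j, t j ≤ univ.sup t := fun j => le_sup (mem_univ j)
  have hW : 9 * m < #W := by omega
  let T : Finset (Fin q) → SimpleGraph V := fun I => fromEdgeSet ((I.biUnion E : Finset _) : Set _)
  have hTmono : ∀ I, ∀ j ∈ I, fromEdgeSet (E j : Set (Sym2 V)) ≤ T I := fun I j hj =>
    fromEdgeSet_mono (coe_subset.2 (subset_biUnion_of_mem E hj))
  let near : Finset (Fin q) → Prop := fun I =>
    ∃ v, ∃ C ⊆ W, (∀ w ∈ C, (T I).Reachable v w) ∧ #W ≤ #C + 3 * m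
  have hnear_card : ∀ I, near I → #W ≤ ∑ j ∈ I, #(E j) + 1 + 3 * m := by
    rintro I ⟨v, C, -, hv, hC⟩
    have h1 := card_le_card_edges_add_one_of_reachable _ v C hv
    have h2 : #(I.biUnion E) ≤ ∑ j ∈ I, #(E j) := card_biUnion_le
    omega
  have hnear_compl : ∀ I, near I ∨ near Iᶜ := by
    intro I
    refine exists_large_class_of_cover G m hG (T I).reachableSetoid (T Iᶜ).reachableSetoid W hW ?_
    intro x hx y hy hxy
    have h := hreach (c ⟨s(x, y), hxy⟩) x (hWS x hx _) y (hWS y hy _)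
      ((EdgeLabeling.labelGraph_adj x y).2 ⟨hxy, rfl⟩)
    by_cases hI : c ⟨s(x, y), hxy⟩ ∈ I
    · exact .inl (h.mono (hTmono I _ hI))
    · exact .inr (h.mono (hTmono Iᶜ _ (mem_compl.2 hI)))
  have hnear_empty : ¬ near ∅ := by
    intro h
    have h1 := hnear_card ∅ h
    have h2 := hsup ⟨0, hq⟩
    have h3 := ht ⟨0, hq⟩
    rw [sum_empty] at h1
    omega
  -- Otherwise failure of `near` passes from I to Iᶜ's success and on to failure for `insert k I`,
  -- hence to every set.
  obtain ⟨k, I, hkI, h1, h2⟩ : ∃ k, ∃ I : Finset (Fin q), k ∉ I ∧ near (insert k I) ∧ near Iᶜ := by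
    by_contra! hno
    have hall : ∀ I, ¬ near I := by
      intro I
      induction I using Finset.induction_on with
      | empty => exact hnear_empty
      | insert k I hk ih =>
        exact fun h => hno k I hk h ((hnear_compl I).resolve_left ih)
    exact (hnear_compl ∅).elim (hall _) (hall _)
  have h1 := hnear_card _ h1
  have h2 := hnear_card _ h2
  rw [sum_insert hkI] at h1
  have hsum := sum_add_sum_compl I fun j => #(E j)
  have htot : 2 * ∑ j, #(S j) + ∑ j, #(E j) ≤ 2 * ∑ j, (t j - 1) := by
    rw [mul_sum, mul_sum, ← sum_add_distrib]
    exact sum_le_sum fun j _ => hSE j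
  have hk := hSE k
  have hk' := hsup k
  have hk'' := ht k
  omega
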